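/- For $\alpha>0$ and $c>0$ let $\operatorname{Par}(\alpha,c)$ denote the Pareto distribution with shape $\alpha$ and scale $c$, that is, the probability distribution on $\mathbb{R}$ with density $f(t)=\alpha c^{\alpha}t^{-\alpha-1}1(t>c)$. For probability distributions $\mu,\nu$ on $\mathbb{R}$ write $\mu\le_{\mathrm{cx}}\nu$ (respectively $\mu\le_{\mathrm{icx}}\nu$, $\mu\le_{\mathrm{icv}}\nu$) if $\int\phi\,d\mu\le\int\phi\,d\nu$ for all convex (respectively nondecreasing convex, nondecreasing concave) functions $\phi:\mathbb{R}\to\mathbb{R}$ that are integrable with respect to both $\mu$ and $\nu$. Theorem. For $i=1,2$ let $\mu_i=\operatorname{Par}(\alpha_i,c_i)$ with $\alpha_i>1$ and $c_i>0$. Then $\mu_i$ has the finite mean $\lambda_i=c_i(1-1/\alpha_i)^{-1}$, and: (i) $\mu_1\le_{\mathrm{icx}}\mu_2$ if and only if $\lambda_1\le\lambda_2$ and $\alpha_1\ge\alpha_2$. (ii) $\mu_1\le_{\mathrm{cx}}\mu_2$ if and only if $\lambda_1=\lambda_2$ and $\alpha_1\ge\alpha_2$. (iii) $\mu_1\le_{\mathrm{icv}}\mu_2$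 if and only if $\lambda_1\le\lambda_2$ and $c_1\le c_2$. -/

import Mathlib

/-!
If `E` is standard exponential, then `c * exp (E / α)` has law `Par α c`. Coupling two Pareto laws
through the same `E`, the logarithms of the two variables are affine in `E` with slopes `1 / αᵢ`.
Hence either one variable dominates the other, or the two cross exactly once and the one of smaller
shape is the more spread out. In the latter case the subgradient of a convex `φ` at the crossing
level bounds the difference of the `φ`-integrals below by a multiple of the difference of the means
(the coupled form of the Karlin–Novikov cut criterion), which gives the sufficient conditions.

Conversely, the mean is detected by the test functions `x` and `-x`, the shape by the blow-up of
the moment of order `p` as `p` increases to the shape, and the scale by `min (x - c) 0`, whose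
integral vanishes exactly for the laws supported on `[c, ∞)`.
-/

/-- The Pareto distribution `Par(α, c)` with shape `α` and scale `c`
(Mathlib's `paretoMeasure` takes the scale first). -/
noncomputable def Par (α c : ℝ) : MeasureTheory.Measure ℝ :=
  ProbabilityTheory.paretoMeasure c α

/-- The mean (first moment) of a distribution on the real line. -/
noncomputable def distMean (μ : MeasureTheory.Measure ℝ) : ℝ :=
  ∫ x, x ∂μ

/-- The integral stochastic order generated by a class `C` of test functions: `∫ φ dμ ≤ ∫ φ dν`
for all `φ ∈ C` such that both integrals exist. -/
def IntegralOrder (C : Set (ℝ → ℝ)) (μ ν : MeasureTheory.Measure ℝ) : Prop :=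
  ∀ φ ∈ C, MeasureTheory.Integrable φ μ → MeasureTheory.Integrable φ ν →
    ∫ x, φ x ∂μ ≤ ∫ x, φ x ∂ν

/-- The convex stochastic order. -/
def ConvexOrder (μ ν : MeasureTheory.Measure ℝ) : Prop :=
  IntegralOrder {φ | ConvexOn ℝ Set.univ φ} μ ν

/-- The increasing convex stochastic order (increasing means nondecreasing). -/
def IncreasingConvexOrder (μ ν : MeasureTheory.Measure ℝ) : Prop :=
  IntegralOrder {φ | Monotone φ ∧ ConvexOn ℝ Set.univ φ} μ ν

/-- The increasing concave stochastic order (increasing means nondecreasing). -/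
def IncreasingConcaveOrder (μ ν : MeasureTheory.Measure ℝ) : Prop :=
  IntegralOrder {φ | Monotone φ ∧ ConcaveOn ℝ Set.univ φ} μ ν

open MeasureTheory ProbabilityTheory Real Set Filter Topology

section ConvexFunctions

lemma rightDeriv_mul_sub_le_of_convexOn {φ : ℝ → ℝ} (hφ : ConvexOn ℝ univ φ) (x y : ℝ) :
    derivWithin φ (Ioi x) x * (y - x) ≤ φ y - φ x := by
  have hx : x ∈ interior (univ : Set ℝ) := by simp
  rcases lt_trichotomy x y with hxy | rfl | hyx
  · have hslope := hφ.rightDeriv_le_slope_of_mem_interior hx (mem_univ y) hxy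
    rwa [slope_def_field, le_div_iff₀ (sub_pos.2 hxy)] at hslope
  · simp
  · have hslope := (hφ.slope_le_leftDeriv_of_mem_interior (mem_univ y) hx hyx).trans
      (hφ.leftDeriv_le_rightDeriv_of_mem_interior hx)
    rw [slope_def_field, div_le_iff₀ (sub_pos.2 hyx)] at hslope
    linarith

lemma rightDeriv_mul_sub_le_of_mul_sub_nonneg {φ : ℝ → ℝ} (hφ : ConvexOn ℝ univ φ) {x₀ x y : ℝ}
    (h : 0 ≤ (x - x₀) * (y - x)) :
    derivWithin φ (Ioi x₀) x₀ * (y - x) ≤ φ y - φ x := by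
  refine le_trans ?_ (rightDeriv_mul_sub_le_of_convexOn hφ x y)
  have hmono : Monotone fun x => derivWithin φ (Ioi x) x := fun a b hab =>
    hφ.monotoneOn_rightDeriv (by simp) (by simp) hab
  rcases lt_trichotomy x₀ x with hx | rfl | hx
  · exact mul_le_mul_of_nonneg_right (hmono hx.le) (nonneg_of_mul_nonneg_right h (sub_pos.2 hx))
  · rfl
  · exact mul_le_mul_of_nonpos_right (hmono hx.le) (by nlinarith)

lemma convexOn_max_zero_rpow {p : ℝ} (hp : 1 ≤ p) :
    ConvexOn ℝ univ fun x : ℝ => max x 0 ^ p := by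
  have himage : (fun x : ℝ => max x 0) '' univ ⊆ Ici 0 := by
    rintro _ ⟨x, -, rfl⟩
    exact le_max_right x 0
  have hmax : ConvexOn ℝ univ fun x : ℝ => max x 0 :=
    (convexOn_id convex_univ).sup (convexOn_const 0 convex_univ)
  refine ConvexOn.comp (g := fun x : ℝ => x ^ p) ((convexOn_rpow hp).subset himage ?_) hmax ?_
  · exact (isPreconnected_univ.image _ (by fun_prop)).ordConnected.convex
  · exact (monotoneOn_rpow_Ici_of_exponent_nonneg (by linarith)).mono himage

lemma monotone_max_zero_rpow {p : ℝ} (hp : 0 ≤ p) : Monotone fun x : ℝ => max x 0 ^ p :=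
  fun _ _ h => rpow_le_rpow (le_max_right _ _) (max_le_max_right 0 h) hp

end ConvexFunctions

section NecessaryConditions

variable {μ ν : Measure ℝ}

lemma IncreasingConvexOrder.distMean_le (h : IncreasingConvexOrder μ ν)
    (hμ : Integrable (fun x => x) μ) (hν : Integrable (fun x => x) ν) :
    distMean μ ≤ distMean ν :=
  h _ ⟨monotone_id, convexOn_id convex_univ⟩ hμ hν

lemma IncreasingConcaveOrder.distMean_le (h : IncreasingConcaveOrder μ ν)
    (hμ : Integrable (fun x => x) μ) (hν : Integrable (fun x => x) ν) :
    distMean μ ≤ distMean ν :=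
  h _ ⟨monotone_id, concaveOn_id convex_univ⟩ hμ hν

lemma ConvexOrder.increasingConvexOrder (h : ConvexOrder μ ν) : IncreasingConvexOrder μ ν :=
  fun φ hφ => h φ hφ.2

lemma ConvexOrder.distMean_eq (h : ConvexOrder μ ν)
    (hμ : Integrable (fun x => x) μ) (hν : Integrable (fun x => x) ν) :
    distMean μ = distMean ν := by
  refine (h.increasingConvexOrder.distMean_le hμ hν).antisymm ?_
  have hneg := h (fun x => -x) (concaveOn_id convex_univ).neg hμ.neg hν.neg
  rw [integral_neg, integral_neg] at hneg
  exact neg_le_neg_iff.1 hneg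

lemma IncreasingConvexOrder.integral_rpow_le (h : IncreasingConvexOrder μ ν) {p : ℝ} (hp : 1 ≤ p)
    (hμ₀ : ∀ᵐ x ∂μ, 0 ≤ x) (hν₀ : ∀ᵐ x ∂ν, 0 ≤ x)
    (hμ : Integrable (fun x => x ^ p) μ) (hν : Integrable (fun x => x ^ p) ν) :
    ∫ x, x ^ p ∂μ ≤ ∫ x, x ^ p ∂ν := by
  have hmax {ρ : Measure ℝ} (hρ : ∀ᵐ x ∂ρ, 0 ≤ x) :
      (fun x : ℝ => x ^ p) =ᵐ[ρ] fun x => max x 0 ^ p :=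
    hρ.mono fun x hx => by simp only [max_eq_left hx]
  rw [integral_congr_ae (hmax hμ₀), integral_congr_ae (hmax hν₀)]
  exact h _ ⟨monotone_max_zero_rpow (zero_le_one.trans hp), convexOn_max_zero_rpow hp⟩
    (hμ.congr (hmax hμ₀)) (hν.congr (hmax hν₀))

lemma IncreasingConcaveOrder.ae_le (h : IncreasingConcaveOrder μ ν) {a : ℝ}
    (hν : Integrable (fun x => min (x - a) 0) ν) (hμa : ∀ᵐ x ∂μ, a ≤ x) :
    ∀ᵐ x ∂ν, a ≤ x := by
  have hμ_zero : (fun x => min (x - a) 0) =ᵐ[μ] 0 :=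
    hμa.mono fun x hx => min_eq_right (sub_nonneg.2 hx)
  have hmono : Monotone fun x : ℝ => min (x - a) 0 :=
    fun x y hxy => min_le_min_right 0 (sub_le_sub_right hxy a)
  have hconc : ConcaveOn ℝ univ fun x : ℝ => min (x - a) 0 :=
    ((concaveOn_id convex_univ).sub (convexOn_const a convex_univ)).inf
      (concaveOn_const 0 convex_univ)
  have hle := h _ ⟨hmono, hconc⟩ ((integrable_zero _ _ _).congr hμ_zero.symm) hν
  rw [integral_eq_zero_of_ae hμ_zero] at hle
  have hneg_nonneg : 0 ≤ fun x : ℝ => -min (x - a) 0 :=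
    fun x => neg_nonneg.2 (min_le_right _ _)
  have hneg_zero : ∫ x, -min (x - a) 0 ∂ν = 0 :=
    le_antisymm (by rw [integral_neg]; linarith) (integral_nonneg hneg_nonneg)
  filter_upwards [(integral_eq_zero_iff_of_nonneg hneg_nonneg hν.neg).1 hneg_zero] with x hx
  exact sub_nonneg.1 (min_eq_right_iff.1 (neg_eq_zero.1 hx))

end NecessaryConditions

section Couplings

/-- `Y` is obtained from `X` by moving mass away from the level `x₀`: almost surely `X ≤ Y` where
`x₀ < X`, and `Y ≤ X` where `X < x₀`. This is the single-crossing condition of the cut criterion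
for convex orders, encoded by one sign condition. -/
def SpreadsAwayFrom {Ω : Type*} [MeasurableSpace Ω] (x₀ : ℝ) (P : Measure Ω) (X Y : Ω → ℝ) : Prop :=
  ∀ᵐ ω ∂P, 0 ≤ (X ω - x₀) * (Y ω - X ω)

variable {Ω : Type*} [MeasurableSpace Ω] {P : Measure Ω} {X Y : Ω → ℝ} {μ ν : Measure ℝ} {x₀ : ℝ}

lemma integrable_comp_of_hasLaw (hX : HasLaw X μ P) {φ : ℝ → ℝ} (hφ : Integrable φ μ) :
    Integrable (fun ω => φ (X ω)) P := by
  rw [← hX.map_eq] at hφ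
  exact hφ.comp_aemeasurable hX.aemeasurable

lemma IntegralOrder.of_ae_le {C : Set (ℝ → ℝ)} (hC : ∀ φ ∈ C, Monotone φ)
    (hX : HasLaw X μ P) (hY : HasLaw Y ν P) (hXY : X ≤ᵐ[P] Y) : IntegralOrder C μ ν := by
  intro φ hφ hμ hν
  rw [← hX.integral_comp hμ.aestronglyMeasurable, ← hY.integral_comp hν.aestronglyMeasurable]
  exact integral_mono_ae (integrable_comp_of_hasLaw hX hμ) (integrable_comp_of_hasLaw hY hν)
    (hXY.mono fun _ hω => hC φ hφ hω)

lemma SpreadsAwayFrom.rightDeriv_mul_distMean_sub_le (h : SpreadsAwayFrom x₀ P X Y)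
    (hX : HasLaw X μ P) (hY : HasLaw Y ν P)
    (hμ : Integrable (fun x => x) μ) (hν : Integrable (fun x => x) ν) {φ : ℝ → ℝ}
    (hφ : ConvexOn ℝ univ φ) (hφμ : Integrable φ μ) (hφν : Integrable φ ν) :
    derivWithin φ (Ioi x₀) x₀ * (distMean ν - distMean μ) ≤ ∫ x, φ x ∂ν - ∫ x, φ x ∂μ := by
  have hiX := integrable_comp_of_hasLaw hX hμ
  have hiY := integrable_comp_of_hasLaw hY hν
  have hiφX := integrable_comp_of_hasLaw hX hφμ
  have hiφY := integrable_comp_of_hasLaw hY hφν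
  rw [distMean, distMean, ← hX.integral_eq, ← hY.integral_eq,
    ← hX.integral_comp hφμ.aestronglyMeasurable, ← hY.integral_comp hφν.aestronglyMeasurable]
  simp only [Function.comp_apply]
  rw [← integral_sub hiY hiX, ← integral_sub hiφY hiφX, ← integral_const_mul]
  exact integral_mono_ae ((hiY.sub hiX).const_mul _) (hiφY.sub hiφX)
    (h.mono fun _ hω => rightDeriv_mul_sub_le_of_mul_sub_nonneg hφ hω)

lemma SpreadsAwayFrom.increasingConvexOrder (h : SpreadsAwayFrom x₀ P X Y)
    (hX : HasLaw X μ P) (hY : HasLaw Y ν P)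
    (hμ : Integrable (fun x => x) μ) (hν : Integrable (fun x => x) ν)
    (hmean : distMean μ ≤ distMean ν) : IncreasingConvexOrder μ ν := by
  rintro φ ⟨hmono, hφ⟩ hφμ hφν
  have hslope : 0 ≤ derivWithin φ (Ioi x₀) x₀ := (hmono.monotoneOn _).derivWithin_nonneg
  exact sub_nonneg.1 <| (mul_nonneg hslope (sub_nonneg.2 hmean)).trans
    (h.rightDeriv_mul_distMean_sub_le hX hY hμ hν hφ hφμ hφν)

lemma SpreadsAwayFrom.convexOrder (h : SpreadsAwayFrom x₀ P X Y)
    (hX : HasLaw X μ P) (hY : HasLaw Y ν P)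
    (hμ : Integrable (fun x => x) μ) (hν : Integrable (fun x => x) ν)
    (hmean : distMean μ = distMean ν) : ConvexOrder μ ν := by
  intro φ hφ hφμ hφν
  have hle := h.rightDeriv_mul_distMean_sub_le hX hY hμ hν hφ hφμ hφν
  rw [hmean, sub_self, mul_zero] at hle
  exact sub_nonneg.1 hle

lemma SpreadsAwayFrom.increasingConcaveOrder (h : SpreadsAwayFrom x₀ P X Y)
    (hX : HasLaw X μ P) (hY : HasLaw Y ν P)
    (hμ : Integrable (fun x => x) μ) (hν : Integrable (fun x => x) ν)
    (hmean : distMean ν ≤ distMean μ) : IncreasingConcaveOrder ν μ := by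
  rintro φ ⟨hmono, hφ⟩ hφν hφμ
  have hslope : derivWithin (-φ) (Ioi x₀) x₀ ≤ 0 :=
    (hmono.neg.antitoneOn _).derivWithin_nonpos
  have hle := (mul_nonneg_of_nonpos_of_nonpos hslope (sub_nonpos.2 hmean)).trans
    (h.rightDeriv_mul_distMean_sub_le hX hY hμ hν hφ.neg hφμ.neg hφν.neg)
  simp only [Pi.neg_apply, integral_neg] at hle
  linarith

end Couplings

section Pareto

variable {α c : ℝ}

lemma isProbabilityMeasure_Par (hα : 0 < α) (hc : 0 < c) : IsProbabilityMeasure (Par α c) :=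
  isProbabilityMeasure_paretoMeasure hc hα

lemma paretoPDFReal_eq_indicator :
    paretoPDFReal c α = (Ici c).indicator fun x => α * c ^ α * x ^ (-(α + 1)) := rfl

lemma cdf_Par (hα : 0 < α) (hc : 0 < c) (x : ℝ) :
    cdf (Par α c) x = if c ≤ x then 1 - (c / x) ^ α else 0 := by
  rw [Par, cdf_paretoMeasure_eq_integral hc hα, paretoPDFReal_eq_indicator,
    setIntegral_indicator measurableSet_Ici, inter_comm, Ici_inter_Iic]
  split_ifs with hx
  · have hx_pos : 0 < x := hc.trans_le hx
    have hzero : (0 : ℝ) ∉ uIcc c x := by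
      rw [uIcc_of_le hx]
      exact fun h => hc.not_ge h.1
    rw [integral_Icc_eq_integral_Ioc, ← intervalIntegral.integral_of_le hx,
      intervalIntegral.integral_const_mul, integral_rpow (Or.inr ⟨by linarith, hzero⟩),
      neg_add, neg_add_cancel_right, rpow_neg hx_pos.le, rpow_neg hc.le, div_rpow hc.le hx_pos.le]
    field_simp
    ring
  · rw [Icc_eq_empty hx, setIntegral_empty]

lemma ae_le_Par_iff (hα : 0 < α) (hc : 0 < c) {a : ℝ} : (∀ᵐ x ∂Par α c, a ≤ x) ↔ a ≤ c := by
  have := isProbabilityMeasure_Par hα hc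
  simp only [ae_iff, not_le]
  constructor
  · intro hnull
    by_contra! hca
    obtain ⟨x, hcx, hxa⟩ := exists_between hca
    have hcdf : cdf (Par α c) x = 0 := by
      rw [cdf_eq_real, measureReal_eq_zero_iff]
      exact measure_mono_null (fun y hy => lt_of_le_of_lt hy hxa) hnull
    have hlt : (c / x) ^ α < 1 :=
      rpow_lt_one (by have := hc.trans hcx; positivity) ((div_lt_one (hc.trans hcx)).2 hcx) hα
    rw [cdf_Par hα hc, if_pos hcx.le] at hcdf
    linarith
  · intro hac
    have hcdf : cdf (Par α c) c = 0 := by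
      rw [cdf_Par hα hc, if_pos le_rfl, div_self hc.ne', one_rpow, sub_self]
    rw [cdf_eq_real, measureReal_eq_zero_iff] at hcdf
    exact measure_mono_null (fun y hy => (lt_of_lt_of_le hy hac).le) hcdf

lemma measurable_paretoPDF (α c : ℝ) : Measurable (paretoPDF c α) :=
  (measurable_paretoPDFReal c α).ennreal_ofReal

lemma toReal_paretoPDF_smul_rpow (hα : 0 < α) (hc : 0 < c) (p : ℝ) :
    (fun x => (paretoPDF c α x).toReal • x ^ p) =
      (Ici c).indicator fun x => α * c ^ α * x ^ (p - α - 1) := by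
  ext x
  rw [paretoPDF, ENNReal.toReal_ofReal (paretoPDFReal_nonneg hc.le hα.le x), smul_eq_mul,
    paretoPDFReal_eq_indicator]
  by_cases hx : x ∈ Ici c
  · rw [indicator_of_mem hx, indicator_of_mem hx, mul_assoc, ← rpow_add (hc.trans_le hx)]
    ring_nf
  · rw [indicator_of_notMem hx, indicator_of_notMem hx, zero_mul]

lemma integrable_rpow_Par (hα : 0 < α) (hc : 0 < c) {p : ℝ} (hp : p < α) :
    Integrable (fun x => x ^ p) (Par α c) := by
  rw [Par, paretoMeasure, integrable_withDensity_iff_integrable_smul'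
      (measurable_paretoPDF α c) (ae_of_all _ fun _ => ENNReal.ofReal_lt_top),
    toReal_paretoPDF_smul_rpow hα hc, integrable_indicator_iff measurableSet_Ici,
    integrableOn_Ici_iff_integrableOn_Ioi]
  exact (integrableOn_Ioi_rpow_of_lt (by linarith) hc).const_mul _

lemma integral_rpow_Par (hα : 0 < α) (hc : 0 < c) {p : ℝ} (hp : p < α) :
    ∫ x, x ^ p ∂Par α c = α * c ^ p / (α - p) := by
  rw [Par, paretoMeasure, integral_withDensity_eq_integral_toReal_smul
      (measurable_paretoPDF α c) (ae_of_all _ fun _ => ENNReal.ofReal_lt_top),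
    toReal_paretoPDF_smul_rpow hα hc, integral_indicator measurableSet_Ici,
    integral_Ici_eq_integral_Ioi, integral_const_mul, integral_Ioi_rpow_of_lt (by linarith) hc,
    show p - α - 1 + 1 = -(α - p) by ring, neg_div_neg_eq, mul_div_assoc', mul_assoc, ← rpow_add hc]
  ring_nf

lemma tendsto_integral_rpow_Par_atTop (hα : 0 < α) (hc : 0 < c) :
    Tendsto (fun p : ℝ => ∫ x, x ^ p ∂Par α c) (𝓝[<] α) atTop := by
  have hnum : Tendsto (fun p => α * c ^ p) (𝓝[<] α) (𝓝 (α * c ^ α)) :=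
    ((continuousAt_const_rpow hc.ne').const_mul α).tendsto.mono_left nhdsWithin_le_nhds
  have hden : Tendsto (fun p => α - p) (𝓝[<] α) (𝓝[>] 0) := by
    refine tendsto_nhdsWithin_iff.2 ⟨?_, ?_⟩
    · refine ((continuous_const.sub continuous_id).tendsto' α 0 (sub_self α)).mono_left ?_
      exact nhdsWithin_le_nhds
    · exact eventually_mem_nhdsWithin.mono fun p hp => mem_Ioi.2 (sub_pos.2 hp)
  refine (hnum.pos_mul_atTop (by positivity) hden.inv_tendsto_nhdsGT_zero).congr' ?_
  filter_upwards [self_mem_nhdsWithin] with p hp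
  rw [integral_rpow_Par hα hc hp, div_eq_mul_inv, Pi.inv_apply]

lemma continuousAt_integral_rpow_Par (hα : 0 < α) (hc : 0 < c) {q : ℝ} (hq : q < α) :
    ContinuousAt (fun p : ℝ => ∫ x, x ^ p ∂Par α c) q := by
  have hformula : ContinuousAt (fun p => α * c ^ p / (α - p)) q :=
    ((continuousAt_const_rpow hc.ne').const_mul α).div (by fun_prop) (sub_pos.2 hq).ne'
  refine hformula.congr ?_
  filter_upwards [Iio_mem_nhds hq] with p hp using (integral_rpow_Par hα hc hp).symm

lemma integrable_id_Par (hα : 1 < α) (hc : 0 < c) : Integrable (fun x : ℝ => x) (Par α c) := by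
  simpa only [rpow_one] using integrable_rpow_Par (zero_lt_one.trans hα) hc hα

lemma distMean_Par (hα : 1 < α) (hc : 0 < c) : distMean (Par α c) = c * (1 - 1 / α)⁻¹ := by
  have hα_pos : 0 < α := zero_lt_one.trans hα
  have hmoment := integral_rpow_Par hα_pos hc hα
  simp only [rpow_one] at hmoment
  rw [distMean, hmoment, one_sub_div hα_pos.ne', inv_div]
  ring

lemma distMean_Par_le_distMean_Par_iff {c₁ c₂ : ℝ} (hα : 1 < α) (hc₁ : 0 < c₁) (hc₂ : 0 < c₂) :
    distMean (Par α c₁) ≤ distMean (Par α c₂) ↔ c₁ ≤ c₂ := by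
  have hpos : 0 < (1 - 1 / α)⁻¹ :=
    inv_pos.2 (sub_pos.2 ((div_lt_one (zero_lt_one.trans hα)).2 hα))
  rw [distMean_Par hα hc₁, distMean_Par hα hc₂, mul_le_mul_iff_left₀ hpos]

end Pareto

section ExponentialCoupling

/-- The Pareto variable of shape `α` and scale `c` as a function of the value `t` of a standard
exponential variable. Using the same exponential variable for all `α` and `c` couples all Pareto
laws. -/
noncomputable def paretoOfExp (α c t : ℝ) : ℝ :=
  c * exp (t / α)

variable {α c α₁ α₂ c₁ c₂ : ℝ}

lemma ae_nonneg_expMeasure {r : ℝ} (hr : 0 < r) : ∀ᵐ t ∂expMeasure r, 0 ≤ t := by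
  have := isProbabilityMeasure_expMeasure hr
  have hcdf : cdf (expMeasure r) 0 = 0 := by simp [cdf_expMeasure_eq hr]
  rw [cdf_eq_real, measureReal_eq_zero_iff] at hcdf
  simp only [ae_iff, not_le]
  exact measure_mono_null Iio_subset_Iic_self hcdf

lemma preimage_paretoOfExp_Iic (hα : 0 < α) (hc : 0 < c) {x : ℝ} (hx : 0 < x) :
    paretoOfExp α c ⁻¹' Iic x = Iic (α * log (x / c)) := by
  ext t
  rw [mem_preimage, mem_Iic, mem_Iic, paretoOfExp, ← le_div_iff₀' hc,
    ← le_log_iff_exp_le (by positivity), div_le_iff₀' hα]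

lemma hasLaw_paretoOfExp (hα : 0 < α) (hc : 0 < c) :
    HasLaw (paretoOfExp α c) (Par α c) (expMeasure 1) := by
  have hmeas : Measurable (paretoOfExp α c) := by unfold paretoOfExp; fun_prop
  have := isProbabilityMeasure_Par hα hc
  have := isProbabilityMeasure_expMeasure one_pos
  have := Measure.isProbabilityMeasure_map (μ := expMeasure 1) hmeas.aemeasurable
  refine ⟨hmeas.aemeasurable, Measure.eq_of_cdf _ _ (StieltjesFunction.ext fun x => ?_)⟩
  rw [cdf_Par hα hc, cdf_eq_real, map_measureReal_apply hmeas measurableSet_Iic]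
  rcases le_or_gt x 0 with hx | hx
  · have hempty : paretoOfExp α c ⁻¹' Iic x = ∅ :=
      eq_empty_of_forall_notMem fun t ht => (mul_pos hc (exp_pos _)).not_ge (ht.trans hx)
    rw [hempty, measureReal_empty, if_neg (hx.trans_lt hc).not_ge]
  · have hsign : 0 ≤ α * log (x / c) ↔ c ≤ x := by
      rw [mul_nonneg_iff_of_pos_left hα, log_nonneg_iff (by positivity), one_le_div hc]
    have htail : exp (-(α * log (x / c))) = (c / x) ^ α := by
      rw [← mul_neg, ← log_inv, inv_div, mul_comm, ← rpow_def_of_pos (by positivity)]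
    rw [preimage_paretoOfExp_Iic hα hc hx, ← cdf_eq_real, cdf_expMeasure_eq one_pos, one_mul,
      htail]
    simp only [hsign]

lemma paretoOfExp_le_paretoOfExp_iff (hc₁ : 0 < c₁) (hc₂ : 0 < c₂) {t : ℝ} :
    paretoOfExp α₁ c₁ t ≤ paretoOfExp α₂ c₂ t ↔ log c₁ + t / α₁ ≤ log c₂ + t / α₂ := by
  rw [← exp_le_exp (x := log c₁ + _), exp_add, exp_add, exp_log hc₁, exp_log hc₂, paretoOfExp,
    paretoOfExp]

lemma paretoOfExp_ae_le (hα₂ : 0 < α₂) (hc₁ : 0 < c₁) (hα : α₂ ≤ α₁) (hc : c₁ ≤ c₂) :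
    paretoOfExp α₁ c₁ ≤ᵐ[expMeasure 1] paretoOfExp α₂ c₂ := by
  filter_upwards [ae_nonneg_expMeasure one_pos] with t ht
  have hc₂ : 0 < c₂ := hc₁.trans_le hc
  unfold paretoOfExp
  gcongr

lemma exists_spreadsAwayFrom_paretoOfExp (hα₂ : 0 < α₂) (hc₁ : 0 < c₁) (hc₂ : 0 < c₂)
    (hα : α₂ < α₁) (P : Measure ℝ) :
    ∃ x₀, SpreadsAwayFrom x₀ P (paretoOfExp α₁ c₁) (paretoOfExp α₂ c₂) := by
  have hrate : 0 < 1 / α₂ - 1 / α₁ := sub_pos.2 (one_div_lt_one_div_of_lt hα₂ hα)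
  obtain ⟨t₀, ht₀⟩ : ∃ t₀, (1 / α₂ - 1 / α₁) * t₀ = log c₁ - log c₂ :=
    ⟨_, mul_div_cancel₀ _ hrate.ne'⟩
  have hlog (t : ℝ) : log c₂ + t / α₂ - (log c₁ + t / α₁) = (1 / α₂ - 1 / α₁) * (t - t₀) := by
    rw [mul_sub, ht₀]
    ring
  have hmono : Monotone (paretoOfExp α₁ c₁) := fun s t hst => by
    have hα₁ : 0 < α₁ := hα₂.trans hα
    unfold paretoOfExp
    gcongr
  refine ⟨paretoOfExp α₁ c₁ t₀, ae_of_all _ fun t => ?_⟩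
  rcases le_total t₀ t with ht | ht
  · refine mul_nonneg (sub_nonneg.2 (hmono ht)) (sub_nonneg.2 ?_)
    rw [paretoOfExp_le_paretoOfExp_iff hc₁ hc₂, ← sub_nonneg, hlog]
    exact mul_nonneg hrate.le (sub_nonneg.2 ht)
  · refine mul_nonneg_of_nonpos_of_nonpos (sub_nonpos.2 (hmono ht)) (sub_nonpos.2 ?_)
    rw [paretoOfExp_le_paretoOfExp_iff hc₂ hc₁, ← sub_nonpos, hlog]
    exact mul_nonpos_of_nonneg_of_nonpos hrate.le (sub_nonpos.2 ht)

end ExponentialCoupling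

section ParetoOrders

variable {α₁ α₂ c₁ c₂ : ℝ}

lemma IncreasingConvexOrder.shape_le (h : IncreasingConvexOrder (Par α₁ c₁) (Par α₂ c₂))
    (hα₁ : 1 < α₁) (hc₁ : 0 < c₁) (hc₂ : 0 < c₂) : α₂ ≤ α₁ := by
  by_contra! hlt
  have hα₁_pos : 0 < α₁ := zero_lt_one.trans hα₁
  have hα₂_pos : 0 < α₂ := hα₁_pos.trans hlt
  have hmoment : ∀ᶠ p in 𝓝[<] α₁, ∫ x, x ^ p ∂Par α₁ c₁ ≤ ∫ x, x ^ p ∂Par α₂ c₂ := by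
    filter_upwards [Ioo_mem_nhdsLT hα₁] with p hp
    exact h.integral_rpow_le hp.1.le ((ae_le_Par_iff hα₁_pos hc₁).2 hc₁.le)
      ((ae_le_Par_iff hα₂_pos hc₂).2 hc₂.le) (integrable_rpow_Par hα₁_pos hc₁ hp.2)
      (integrable_rpow_Par hα₂_pos hc₂ (hp.2.trans hlt))
  exact not_tendsto_nhds_of_tendsto_atTop
    (tendsto_atTop_mono' _ hmoment (tendsto_integral_rpow_Par_atTop hα₁_pos hc₁)) _
    ((continuousAt_integral_rpow_Par hα₂_pos hc₂ hlt).tendsto.mono_left nhdsWithin_le_nhds)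

lemma IncreasingConcaveOrder.scale_le (h : IncreasingConcaveOrder (Par α₁ c₁) (Par α₂ c₂))
    (hα₁ : 0 < α₁) (hα₂ : 1 < α₂) (hc₁ : 0 < c₁) (hc₂ : 0 < c₂) : c₁ ≤ c₂ := by
  have hα₂_pos : 0 < α₂ := zero_lt_one.trans hα₂
  have := isProbabilityMeasure_Par hα₂_pos hc₂
  have hint : Integrable (fun x => min (x - c₁) 0) (Par α₂ c₂) :=
    ((integrable_id_Par hα₂ hc₂).sub (integrable_const c₁)).inf (integrable_zero _ _ _)
  exact (ae_le_Par_iff hα₂_pos hc₂).1 (h.ae_le hint ((ae_le_Par_iff hα₁ hc₁).2 le_rfl))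

lemma integralOrder_Par_of_shape_le_of_scale_le {C : Set (ℝ → ℝ)} (hC : ∀ φ ∈ C, Monotone φ)
    (hα₂ : 0 < α₂) (hc₁ : 0 < c₁) (hα : α₂ ≤ α₁) (hc : c₁ ≤ c₂) :
    IntegralOrder C (Par α₁ c₁) (Par α₂ c₂) :=
  IntegralOrder.of_ae_le hC (hasLaw_paretoOfExp (hα₂.trans_le hα) hc₁)
    (hasLaw_paretoOfExp hα₂ (hc₁.trans_le hc)) (paretoOfExp_ae_le hα₂ hc₁ hα hc)

lemma increasingConvexOrder_Par_iff (hα₁ : 1 < α₁) (hα₂ : 1 < α₂) (hc₁ : 0 < c₁) (hc₂ : 0 < c₂) :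
    IncreasingConvexOrder (Par α₁ c₁) (Par α₂ c₂) ↔
      distMean (Par α₁ c₁) ≤ distMean (Par α₂ c₂) ∧ α₁ ≥ α₂ := by
  have hα₁_pos : 0 < α₁ := zero_lt_one.trans hα₁
  have hα₂_pos : 0 < α₂ := zero_lt_one.trans hα₂
  have hi₁ := integrable_id_Par hα₁ hc₁
  have hi₂ := integrable_id_Par hα₂ hc₂
  refine ⟨fun h => ⟨h.distMean_le hi₁ hi₂, h.shape_le hα₁ hc₁ hc₂⟩, ?_⟩
  rintro ⟨hmean, hα⟩
  rcases hα.lt_or_eq with hα | rfl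
  · obtain ⟨x₀, hspread⟩ :=
      exists_spreadsAwayFrom_paretoOfExp hα₂_pos hc₁ hc₂ hα (expMeasure 1)
    exact hspread.increasingConvexOrder (hasLaw_paretoOfExp hα₁_pos hc₁)
      (hasLaw_paretoOfExp hα₂_pos hc₂) hi₁ hi₂ hmean
  · exact integralOrder_Par_of_shape_le_of_scale_le (fun _ hφ => hφ.1) hα₂_pos hc₁ le_rfl
      ((distMean_Par_le_distMean_Par_iff hα₁ hc₁ hc₂).1 hmean)

lemma convexOrder_Par_iff (hα₁ : 1 < α₁) (hα₂ : 1 < α₂) (hc₁ : 0 < c₁) (hc₂ : 0 < c₂) :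
    ConvexOrder (Par α₁ c₁) (Par α₂ c₂) ↔
      distMean (Par α₁ c₁) = distMean (Par α₂ c₂) ∧ α₁ ≥ α₂ := by
  have hi₁ := integrable_id_Par hα₁ hc₁
  have hi₂ := integrable_id_Par hα₂ hc₂
  refine ⟨fun h => ⟨h.distMean_eq hi₁ hi₂, h.increasingConvexOrder.shape_le hα₁ hc₁ hc₂⟩, ?_⟩
  rintro ⟨hmean, hα⟩
  rcases hα.lt_or_eq with hα | rfl
  · obtain ⟨x₀, hspread⟩ := exists_spreadsAwayFrom_paretoOfExp (zero_lt_one.trans hα₂) hc₁ hc₂ hα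
      (expMeasure 1)
    exact hspread.convexOrder (hasLaw_paretoOfExp (zero_lt_one.trans hα₁) hc₁)
      (hasLaw_paretoOfExp (zero_lt_one.trans hα₂) hc₂) hi₁ hi₂ hmean
  · have hscale : c₁ = c₂ :=
      ((distMean_Par_le_distMean_Par_iff hα₁ hc₁ hc₂).1 hmean.le).antisymm
        ((distMean_Par_le_distMean_Par_iff hα₁ hc₂ hc₁).1 hmean.ge)
    subst hscale
    exact fun _ _ _ _ => le_rfl

lemma increasingConcaveOrder_Par_iff (hα₁ : 1 < α₁) (hα₂ : 1 < α₂) (hc₁ : 0 < c₁) (hc₂ : 0 < c₂) :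
    IncreasingConcaveOrder (Par α₁ c₁) (Par α₂ c₂) ↔
      distMean (Par α₁ c₁) ≤ distMean (Par α₂ c₂) ∧ c₁ ≤ c₂ := by
  have hα₁_pos : 0 < α₁ := zero_lt_one.trans hα₁
  have hα₂_pos : 0 < α₂ := zero_lt_one.trans hα₂
  have hi₁ := integrable_id_Par hα₁ hc₁
  have hi₂ := integrable_id_Par hα₂ hc₂
  refine ⟨fun h => ⟨h.distMean_le hi₁ hi₂, h.scale_le hα₁_pos hα₂ hc₁ hc₂⟩, ?_⟩
  rintro ⟨hmean, hc⟩
  rcases le_or_gt α₂ α₁ with hα | hα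
  · exact integralOrder_Par_of_shape_le_of_scale_le (fun _ hφ => hφ.1) hα₂_pos hc₁ hα hc
  · obtain ⟨x₀, hspread⟩ :=
      exists_spreadsAwayFrom_paretoOfExp hα₁_pos hc₂ hc₁ hα (expMeasure 1)
    exact hspread.increasingConcaveOrder (hasLaw_paretoOfExp hα₂_pos hc₂)
      (hasLaw_paretoOfExp hα₁_pos hc₁) hi₂ hi₁ hmean

end ParetoOrders

theorem mainTheorem5 (α₁ α₂ c₁ c₂ l₁ l₂ : ℝ) (μ₁ μ₂ : MeasureTheory.Measure ℝ)
    (hα₁ : 1 < α₁) (hα₂ : 1 < α₂) (hc₁ : 0 < c₁) (hc₂ : 0 < c₂)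
    (hμ₁ : μ₁ = Par α₁ c₁) (hμ₂ : μ₂ = Par α₂ c₂)
    (hl₁ : l₁ = distMean μ₁) (hl₂ : l₂ = distMean μ₂) :
    -- the means are finite and given by the explicit formula
    (MeasureTheory.Integrable (fun x : ℝ => x) μ₁ ∧ l₁ = c₁ * (1 - 1 / α₁)⁻¹) ∧
    (MeasureTheory.Integrable (fun x : ℝ => x) μ₂ ∧ l₂ = c₂ * (1 - 1 / α₂)⁻¹) ∧
    (IncreasingConvexOrder μ₁ μ₂ ↔ l₁ ≤ l₂ ∧ α₁ ≥ α₂) ∧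
    (ConvexOrder μ₁ μ₂ ↔ l₁ = l₂ ∧ α₁ ≥ α₂) ∧
    (IncreasingConcaveOrder μ₁ μ₂ ↔ l₁ ≤ l₂ ∧ c₁ ≤ c₂) := by
  subst hμ₁ hμ₂ hl₁ hl₂
  exact ⟨⟨integrable_id_Par hα₁ hc₁, distMean_Par hα₁ hc₁⟩,
    ⟨integrable_id_Par hα₂ hc₂, distMean_Par hα₂ hc₂⟩,
    increasingConvexOrder_Par_iff hα₁ hα₂ hc₁ hc₂,
    convexOrder_Par_iff hα₁ hα₂ hc₁ hc₂,
    increasingConcaveOrder_Par_iff hα₁ hα₂ hc₁ hc₂⟩
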